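/- **Generalized Mehler formula.** Let $d\ge 1$ and let $Q,B$ be real $d\times d$ matrices with $Q$ symmetric nonnegative definite. Put $$Q_t=\int_0^t e^{sB}Qe^{sB^*}\,ds\quad(t>0),\qquad Q_\infty=\int_0^\infty e^{sB}Qe^{sB^*}\,ds .$$ Assume that $\det Q_t>0$ for all $t>0$, that all eigenvalues of $B$ have negative real part, and that $B$ is diagonalizable with real eigenvalues: $MBM^{-1}=-\operatorname{diag}(\lambda_1,\dots,\lambda_d)$ for a real invertible matrix $M$, where $\lambda_1\le\dots\le\lambda_d$ (so $\lambda_1>0$). Let $\varrho$ be the smallest eigenvalue of $\lambda_1MQ_\infty M^*$, let $D=\operatorname{diag}\big(\sqrt{\lambda_1/\varrho},\dots,\sqrt{\lambda_d/\varrho}\big)$, and let $$\mu(x)=\frac{1}{(2\pi)^{d/2}\sqrt{\det Q_\infty}}\,e^{-\frac12\langle Q_\infty^{-1}x,x\rangle}$$ be the density of the invariant distribution of the Ornstein–Uhlenbeck semigroup generated by $\frac12\operatorname{tr}(Q\nabla^2)+\langle Bx,\nabla\rangle$. For $n\in\mathbb N_0^d$ write $|n|=\sum_i n_i$, $n!=\prod_i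 n_i!$, $\langle n,\lambda\rangle=\sum_i n_i\lambda_i$, and define * the eigenfunctions $\mathcal H_n$ as the coefficients of the power series $$\exp\!\Big(\langle Mx,Dz\rangle-\tfrac12\langle Q_\infty M^*Dz,\,M^*Dz\rangle\Big)=\sum_{n\in\mathbb N_0^d}\mathcal H_n(x)\frac{z^n}{\sqrt{n!}},$$ that is, $\mathcal H_n(x)=\frac1{\sqrt{n!}}\,\partial_z^n\big|_{z=0}$ of the left-hand side; * the co-eigenfunctions $$\mathcal G_n(x)=\frac{(-1)^{|n|}}{\sqrt{n!}}\,\frac{\partial_u^{n}\big[\mu\big((DM)^{-1}u\big)\big]_{u=DMx}}{\mu(x)},$$ the derivatives being taken in the coordinates $u=DMx$. Then there exists $t_0>0$ (depending on $Q$, $B$ and the chosen diagonalization) such that for all $t>t_0$ and all $x,y\in\mathbb R^d$ the series below converges absolutely and $$\sum_{n\in\mathbb N_0^d}e^{-t\langle n,\lambda\rangle}\mathcal H_n(x)\,\mathcal G_n(y)=\sqrt{\frac{\det Q_\infty}{\det Q_t}}\;\exp\!\Big(\tfrac12\langle Q_\infty^{-1}y,y\rangle-\tfrac12\big\langle Q_t^{-1}(e^{tB}x-y),\,e^{tB}x-y\big\rangle\Big).$$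 -/

import Mathlib

open scoped Matrix

noncomputable section

namespace OUMehler

/-- `Q_t = ∫₀ᵗ e^{sB} Q e^{sB*} ds`, integrated entry by entry. -/
def Qt {d : ℕ} (Q B : Matrix (Fin d) (Fin d) ℝ) (t : ℝ) : Matrix (Fin d) (Fin d) ℝ :=
  Matrix.of fun i j =>
    ∫ s in (0 : ℝ)..t, (NormedSpace.exp (s • B) * Q * NormedSpace.exp (s • Bᵀ)) i j

/-- `Q_∞ = ∫₀^∞ e^{sB} Q e^{sB*} ds`, integrated entry by entry. -/
def Qinf {d : ℕ} (Q B : Matrix (Fin d) (Fin d) ℝ) : Matrix (Fin d) (Fin d) ℝ :=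
  Matrix.of fun i j =>
    ∫ s in Set.Ioi (0 : ℝ), (NormedSpace.exp (s • B) * Q * NormedSpace.exp (s • Bᵀ)) i j

/-- The density of the invariant distribution of the diffusion Ornstein-Uhlenbeck semigroup with
generator `½ tr(Q ∇²) + ⟨Bx, ∇⟩`: the centred Gaussian density with covariance matrix `Q_∞`. -/
def invDensity {d : ℕ} (Q B : Matrix (Fin d) (Fin d) ℝ) (x : Fin d → ℝ) : ℝ :=
  ((2 * Real.pi) ^ ((d : ℝ) / 2) * Real.sqrt (Qinf Q B).det)⁻¹ *
    Real.exp (-(1 / 2) * (((Qinf Q B)⁻¹ *ᵥ x) ⬝ᵥ x))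

/-- The partial derivative `∂/∂x_i`. -/
def partialD {d : ℕ} (i : Fin d) (f : (Fin d → ℝ) → ℝ) : (Fin d → ℝ) → ℝ :=
  fun x => lineDeriv ℝ f x (Pi.single i 1)

/-- The multi-index derivative `∂ⁿ = (∂/∂x_1)^{n_1} ⋯ (∂/∂x_d)^{n_d}`. -/
def multiD {d : ℕ} (n : Fin d → ℕ) (f : (Fin d → ℝ) → ℝ) : (Fin d → ℝ) → ℝ :=
  (List.finRange d).foldr (fun i g => (partialD i)^[n i] g) f

/-- `n! = n_1! ⋯ n_d!`. -/
def multiFactorial {d : ℕ} (n : Fin d → ℕ) : ℕ := ∏ i, (n i).factorial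

/-- `⟨n, λ⟩ = n_1 λ_1 + ⋯ + n_d λ_d`. -/
def pairing {d : ℕ} (n : Fin d → ℕ) (l : Fin d → ℝ) : ℝ := ∑ i, (n i : ℝ) * l i

/-- `D = diag(√(λ_1/ϱ), …, √(λ_d/ϱ))`. -/
def scaling {d : ℕ} (l : Fin d → ℝ) (ϱ : ℝ) : Matrix (Fin d) (Fin d) ℝ :=
  Matrix.diagonal fun j => Real.sqrt (l j / ϱ)

/-- The generating function `exp(⟨Mx, Dz⟩ - ½ ⟨Q_∞ M*Dz, M*Dz⟩)` of the eigenfunctions. It is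
`exp(⟨Mx, Dz⟩ - zᵀz/2) / F(iz)` for `F(z) = exp(Ψ_∞(M*Dz) + zᵀz/2)` and
`Ψ_∞(ξ) = -½ ⟨Q_∞ ξ, ξ⟩`. -/
def genFun {d : ℕ} (Q B M : Matrix (Fin d) (Fin d) ℝ) (l : Fin d → ℝ) (ϱ : ℝ)
    (x z : Fin d → ℝ) : ℝ :=
  Real.exp ((M *ᵥ x) ⬝ᵥ (scaling l ϱ *ᵥ z) -
    (1 / 2) * ((Qinf Q B *ᵥ (Mᵀ *ᵥ (scaling l ϱ *ᵥ z))) ⬝ᵥ (Mᵀ *ᵥ (scaling l ϱ *ᵥ z))))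

/-- The eigenfunctions: `H_n(x) / √n!` is the coefficient of `zⁿ` in the power series of
`z ↦ genFun x z` at `0`, that is, `H_n(x) = (1/√n!) ∂ⁿ_z|_{z=0} genFun x z`. -/
def eigenfun {d : ℕ} (Q B M : Matrix (Fin d) (Fin d) ℝ) (l : Fin d → ℝ) (ϱ : ℝ)
    (n : Fin d → ℕ) (x : Fin d → ℝ) : ℝ :=
  multiD n (genFun Q B M l ϱ x) 0 / Real.sqrt (multiFactorial n)

/-- The co-eigenfunctions `G_n = ((-1)^{|n|} / √n!) ∂ⁿμ / μ`, where `∂ⁿ` is taken in the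
coordinates `u = DMx`. -/
def coeigenfun {d : ℕ} (Q B M : Matrix (Fin d) (Fin d) ℝ) (l : Fin d → ℝ) (ϱ : ℝ)
    (n : Fin d → ℕ) (x : Fin d → ℝ) : ℝ :=
  (-1) ^ (∑ i, n i) / Real.sqrt (multiFactorial n) *
    (multiD n (fun u => invDensity Q B ((scaling l ϱ * M)⁻¹ *ᵥ u)) ((scaling l ϱ * M) *ᵥ x) /
      invDensity Q B x)

end OUMehler

end

/-!
Put `A = DM`, `S = A Q_∞ Aᵀ` and `E = diag(e^{-tλ_1}, …, e^{-tλ_d})`, so that `A e^{tB} = E A`. In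
the coordinates `u = Ax`, `v = Ay` the generating function of the eigenfunctions is
`exp(⟨u, z⟩ - ½⟨Sz, z⟩)` and `μ` is proportional to `exp(-½⟨S⁻¹v, v⟩)`. Both are Laplace transforms
of a Gaussian variable: if `R Rᵀ = S` and `T Tᵀ = S⁻¹`, and `Z`, `Z'` are independent standard
Gaussian vectors, they are `𝔼 exp⟨u + iRZ, z⟩` and, up to a constant, `𝔼 exp⟨iTZ', v⟩`. Differentiation
under the integral sign (`IsLaplace.multiD`) turns `H_n` and `G_n` into the moments
`𝔼 (u + iRZ)^n` and `𝔼 (-iTZ')^n e^{i⟨TZ', v⟩}`, up to explicit factors (`ofReal_eigenfun`,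
`ofReal_coeigenfun`).

The series over `n` is therefore the expectation of an exponential series in `Z` and `Z'`. Its
absolute values sum to at most `exp ∑ e^{-tλ_k} (|u_k| + |(RZ)_k|) |(TZ')_k|`, which is integrable
once the `e^{-tλ_k}` are small; this is where `t₀` comes from. So sum and expectation may be
exchanged (`hasSum_integral_mul_integral`). Integrating first over `Z` leaves the expectation of
`exp(i⟨TZ', v - Eu⟩ + ½⟨ESE TZ', TZ'⟩)` over `Z'` (`integral_prod_cexp`).

The matrix `T` is chosen by simultaneous diagonalization of `Q_∞` and `Q_t`
(`exists_simultaneous_diagonalization`). Since `Q_∞ = Q_t + e^{tB} Q_∞ e^{tB*}` (`Qinf_eq_add`), the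
last expectation then splits into one-dimensional Gaussian integrals, and their product is the
kernel on the right-hand side (`kernel_eq`).
-/

noncomputable section

namespace OUMehler

open MeasureTheory ProbabilityTheory

/-! ### The multivariate exponential series -/

/-- The multivariate exponential series for nonnegative arguments. It supplies the absolute
convergence of the complex series. -/
theorem hasSum_prod_pow_div_factorial_real {d : ℕ} (x : Fin d → ℝ) (hx : ∀ i, 0 ≤ x i) :
    HasSum (fun n : Fin d → ℕ => ∏ i, x i ^ n i / (n i).factorial) (Real.exp (∑ i, x i)) := by
  induction d with
  | zero => simp
  | succ d ih =>
    have h0 : HasSum (fun k : ℕ => x 0 ^ k / k.factorial) (Real.exp (x 0)) := by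
      rw [Real.exp_eq_exp_ℝ]; exact NormedSpace.expSeries_div_hasSum_exp (x 0)
    have h1 := ih (fun i => x i.succ) (fun i => hx _)
    have hs := h0.summable.mul_of_nonneg h1.summable
      (fun k => div_nonneg (pow_nonneg (hx 0) k) (by positivity))
      (fun n => Finset.prod_nonneg fun i _ => div_nonneg (pow_nonneg (hx _) _) (by positivity))
    have h2 := h0.mul h1 hs
    rw [← (Fin.consEquiv fun _ : Fin (d + 1) => ℕ).hasSum_iff]
    rw [Fin.sum_univ_succ, Real.exp_add]
    refine Eq.mp (congrArg (HasSum · _) (funext fun p => ?_)) h2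
    simp [Fin.prod_univ_succ, Fin.consEquiv, div_mul_div_comm]

theorem hasSum_prod_pow_div_factorial {d : ℕ} (x : Fin d → ℂ) :
    HasSum (fun n : Fin d → ℕ => ∏ i, x i ^ n i / (n i).factorial) (Complex.exp (∑ i, x i)) := by
  induction d with
  | zero => simp
  | succ d ih =>
    have h0 : HasSum (fun k : ℕ => x 0 ^ k / k.factorial) (Complex.exp (x 0)) := by
      rw [Complex.exp_eq_exp_ℂ]; exact NormedSpace.expSeries_div_hasSum_exp (x 0)
    have h1 := ih (fun i => x i.succ)
    have hn := (hasSum_prod_pow_div_factorial_real (fun i : Fin d => ‖x i.succ‖)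
      (fun i => norm_nonneg _)).summable
    have hs := summable_mul_of_summable_norm (R := ℂ)
      (f := fun k : ℕ => x 0 ^ k / k.factorial)
      (g := fun n : Fin d → ℕ => ∏ i, x i.succ ^ n i / (n i).factorial)
      h0.summable.norm (by simpa [norm_prod, norm_div, norm_pow] using hn)
    have h2 := h0.mul h1 hs
    rw [← (Fin.consEquiv fun _ : Fin (d + 1) => ℕ).hasSum_iff]
    rw [Fin.sum_univ_succ, Complex.exp_add]
    refine Eq.mp (congrArg (HasSum · _) (funext fun p => ?_)) h2
    simp [Fin.prod_univ_succ, Fin.consEquiv, div_mul_div_comm]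

/-! ### Derivatives of Laplace transforms -/

/-- A real function whose complexification has derivative `f'` has derivative `f'.re`, and `f'` is
real. -/
theorem ofReal_deriv_eq {f : ℝ → ℝ} {f' : ℂ} {s : ℝ}
    (h : HasDerivAt (fun s => (f s : ℂ)) f' s) : ((deriv f s : ℝ) : ℂ) = f' := by
  have hr : HasDerivAt f f'.re s := by
    simpa [Function.comp_def] using (Complex.reCLM.hasFDerivAt.comp_hasDerivAt s h)
  have hi : HasDerivAt (fun _ : ℝ => (0 : ℝ)) f'.im s := by
    simpa [Function.comp_def] using (Complex.imCLM.hasFDerivAt.comp_hasDerivAt s h)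
  have hi0 : f'.im = 0 := hi.unique (hasDerivAt_const _ _)
  rw [hr.deriv]
  exact Complex.ext (by simp) (by simp [hi0])

section Laplace

variable {Ω : Type*} [MeasurableSpace Ω] {d : ℕ}

/-- The function `f` is the Laplace transform `z ↦ c ∫ P e^{⟨W, z⟩} dμ` with the weight `P`, where
`P` grows at most exponentially in `∑ |W_i|`. -/
structure IsLaplace (μ : Measure Ω) (W : Ω → Fin d → ℂ) (c : ℂ) (P : Ω → ℂ)
    (f : (Fin d → ℝ) → ℝ) : Prop where
  meas : Measurable P
  bound : ∃ C r : ℝ, ∀ ω, ‖P ω‖ ≤ C * Real.exp (r * ∑ i, ‖W ω i‖)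
  eq : ∀ z, (f z : ℂ) = c * ∫ ω, P ω * Complex.exp (∑ i, W ω i * z i) ∂μ

theorem norm_cexp_sum_mul_le (w : Fin d → ℂ) (z : Fin d → ℝ) :
    ‖Complex.exp (∑ i, w i * z i)‖ ≤ Real.exp (‖z‖ * ∑ i, ‖w i‖) := by
  refine (Complex.norm_exp_le_exp_norm _).trans (Real.exp_le_exp.2 ?_)
  refine (norm_sum_le _ _).trans ?_
  rw [Finset.mul_sum]
  refine Finset.sum_le_sum fun i _ => ?_
  rw [norm_mul, mul_comm, Complex.norm_real]
  exact mul_le_mul_of_nonneg_right (norm_le_pi_norm z i) (norm_nonneg _)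

/-- Differentiation under the integral sign: `∂_i` multiplies the weight by `W_i`. -/
theorem IsLaplace.partialD {μ : Measure Ω} {W : Ω → Fin d → ℂ} {c : ℂ} {P : Ω → ℂ}
    {f : (Fin d → ℝ) → ℝ} (hW : Measurable W)
    (hint : ∀ r : ℝ, Integrable (fun ω => Real.exp (r * ∑ i, ‖W ω i‖)) μ)
    (h : IsLaplace μ W c P f) (i : Fin d) :
    IsLaplace μ W c (fun ω => P ω * W ω i) (partialD i f) := by
  have hWi : ∀ j, Measurable fun ω => W ω j := fun j => (measurable_pi_apply j).comp hW
  obtain ⟨C, r, hC⟩ := h.bound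
  have hPW : ∀ ω, ‖P ω * W ω i‖ ≤ C * Real.exp ((r + 1) * ∑ i, ‖W ω i‖) := by
    intro ω
    rw [norm_mul, add_mul, Real.exp_add, ← mul_assoc, one_mul]
    refine mul_le_mul (hC ω) ?_ (norm_nonneg _) ((norm_nonneg _).trans (hC ω))
    have h1 : ‖W ω i‖ ≤ ∑ i, ‖W ω i‖ :=
      Finset.single_le_sum (f := fun i => ‖W ω i‖) (fun _ _ => norm_nonneg _) (Finset.mem_univ i)
    linarith [Real.add_one_le_exp (∑ i, ‖W ω i‖)]
  refine ⟨h.meas.mul (hWi i), ⟨C, r + 1, hPW⟩, fun z => ?_⟩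
  have hmeas : ∀ z : Fin d → ℝ, Measurable fun ω => Complex.exp (∑ i, W ω i * z i) := fun z =>
    Complex.measurable_exp.comp (Finset.measurable_fun_sum _ fun j _ => (hWi j).mul_const _)
  have hC0 : ∀ (Q : Ω → ℂ) (C r : ℝ) (_ : ∀ ω, ‖Q ω‖ ≤ C * Real.exp (r * ∑ i, ‖W ω i‖))
      (R : ℝ) (z : Fin d → ℝ) (_ : ‖z‖ ≤ R) (ω : Ω),
      ‖Q ω * Complex.exp (∑ i, W ω i * z i)‖ ≤ C * Real.exp ((r + R) * ∑ i, ‖W ω i‖) := by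
    intro Q C r hQ R z hz ω
    rw [norm_mul, add_mul, Real.exp_add, ← mul_assoc]
    refine mul_le_mul (hQ ω) ((norm_cexp_sum_mul_le _ _).trans (Real.exp_le_exp.2 ?_))
      (norm_nonneg _) ((norm_nonneg _).trans (hQ ω))
    exact mul_le_mul_of_nonneg_right hz (Finset.sum_nonneg fun _ _ => norm_nonneg _)
  obtain ⟨e, he⟩ : ∃ e : Fin d → ℝ, e = Pi.single i 1 := ⟨_, rfl⟩
  have hline : ∀ (ω : Ω) (s : ℝ), ∑ j, W ω j * (z + s • e) j
      = (∑ j, W ω j * z j) + W ω i * s := by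
    intro ω s
    simp [he, mul_add, Finset.sum_add_distrib, Pi.single_apply, apply_ite Complex.ofReal]
  have hderiv : ∀ (ω : Ω) (s : ℝ), HasDerivAt
      (fun s : ℝ => P ω * Complex.exp (∑ j, W ω j * (z + s • e) j))
      (P ω * W ω i * Complex.exp (∑ j, W ω j * (z + s • e) j)) s := by
    intro ω s
    simp_rw [hline]
    have h1 : HasDerivAt (fun s : ℝ => (∑ j, W ω j * z j) + W ω i * (s : ℂ)) (W ω i) s := by
      simpa using ((Complex.ofRealCLM.hasDerivAt (x := s)).const_mul (W ω i)).const_add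
        (∑ j, W ω j * z j)
    simpa only [mul_assoc, mul_comm (W ω i)] using h1.cexp.const_mul (P ω)
  have hball : ∀ s ∈ Metric.ball (0 : ℝ) 1, ‖z + s • e‖ ≤ ‖z‖ + 1 := by
    intro s hs
    refine (norm_add_le _ _).trans (add_le_add le_rfl ?_)
    rw [norm_smul, he, Pi.norm_single, norm_one, mul_one]
    exact (mem_ball_zero_iff.1 hs).le
  have hF : ∀ z : Fin d → ℝ, AEStronglyMeasurable
      (fun ω => P ω * Complex.exp (∑ j, W ω j * z j)) μ :=
    fun z => (h.meas.mul (hmeas z)).aestronglyMeasurable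
  have key := hasDerivAt_integral_of_dominated_loc_of_deriv_le (μ := μ) (𝕜 := ℝ) (x₀ := 0)
    (F := fun (s : ℝ) ω =>
      P ω * Complex.exp (∑ j, W ω j * (z + s • e) j))
    (F' := fun (s : ℝ) ω => P ω * W ω i *
      Complex.exp (∑ j, W ω j * (z + s • e) j))
    (bound := fun ω => C * Real.exp (((r + 1) + (‖z‖ + 1)) * ∑ i, ‖W ω i‖))
    (Metric.ball_mem_nhds _ one_pos)
    (Filter.Eventually.of_forall fun s => hF _)
    (((hint _).const_mul C).mono' (hF _)
      (Filter.Eventually.of_forall fun ω => hC0 P C r hC _ _ le_rfl ω))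
    ((h.meas.mul (hWi i)).mul (hmeas _)).aestronglyMeasurable
    (Filter.Eventually.of_forall fun ω s hs => hC0 _ C (r + 1) hPW (‖z‖ + 1) _ (hball s hs) ω)
    ((hint _).const_mul C)
    (Filter.Eventually.of_forall fun ω s _ => hderiv ω s)
  have key2 := key.2.const_mul c
  simp_rw [← h.eq] at key2
  rw [OUMehler.partialD, lineDeriv, ← he, ofReal_deriv_eq key2]
  simp only [zero_smul, add_zero]

/-- Higher derivatives of a Laplace transform are moments, `∂ⁿ 𝔼 e^{⟨W, z⟩} = 𝔼 Wⁿ e^{⟨W, z⟩}`. -/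
theorem IsLaplace.multiD {μ : Measure Ω} {W : Ω → Fin d → ℂ} {c : ℂ} {f : (Fin d → ℝ) → ℝ}
    (hW : Measurable W)
    (hint : ∀ r : ℝ, Integrable (fun ω => Real.exp (r * ∑ i, ‖W ω i‖)) μ)
    (h : IsLaplace μ W c (fun _ => 1) f) (n : Fin d → ℕ) :
    IsLaplace μ W c (fun ω => ∏ i, W ω i ^ n i) (OUMehler.multiD n f) := by
  have iter : ∀ (i : Fin d) (k : ℕ) (P : Ω → ℂ) (g : (Fin d → ℝ) → ℝ), IsLaplace μ W c P g →
      IsLaplace μ W c (fun ω => W ω i ^ k * P ω) ((OUMehler.partialD i)^[k] g) := by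
    intro i k P g hg
    induction k with
    | zero => simpa using hg
    | succ k ih =>
      rw [Function.iterate_succ_apply']
      convert ih.partialD hW hint i using 2 with ω
      ring
  have aux : ∀ L : List (Fin d), IsLaplace μ W c (fun ω => (L.map fun i => W ω i ^ n i).prod)
      (L.foldr (fun i g => (OUMehler.partialD i)^[n i] g) f) := by
    intro L
    induction L with
    | nil => simpa using h
    | cons i L ih => simpa using iter i (n i) _ _ ih
  simpa [Fin.prod_univ_def, OUMehler.multiD] using aux (List.finRange d)

end Laplace

/-! ### Gaussian integrals -/

/-- The standard Gaussian measure on `ℝ^d`. -/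
abbrev stdGauss (d : ℕ) : Measure (Fin d → ℝ) := Measure.pi fun _ => gaussianReal 0 1

/-- The expectation of `e^{½(1-δ)X² + cX}` for a standard Gaussian variable `X`. -/
theorem integral_gaussianReal_cexp_quadratic {δ : ℝ} (hδ : 0 < δ) (c : ℂ) :
    ∫ x : ℝ, Complex.exp ((1 - δ) / 2 * x ^ 2 + c * x) ∂gaussianReal 0 1
      = ((Real.sqrt δ)⁻¹ : ℝ) * Complex.exp (c ^ 2 / (2 * δ)) := by
  have hδ' : (δ : ℂ) ≠ 0 := by exact_mod_cast hδ.ne'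
  have hb : (-(δ : ℂ) / 2).re < 0 := by
    rw [show -(δ : ℂ) / 2 = ((-δ / 2 : ℝ) : ℂ) by push_cast; ring, Complex.ofReal_re]; linarith
  have h := integral_cexp_quadratic hb c 0
  rw [integral_gaussianReal_eq_integral_smul one_ne_zero]
  -- The exponent `-½x²` of the density turns `½(1-δ)x²` into `-½δx²`.
  have e : ∀ x : ℝ, gaussianPDFReal 0 1 x • Complex.exp ((1 - δ) / 2 * x ^ 2 + c * x)
      = ((Real.sqrt (2 * Real.pi))⁻¹ : ℝ) * Complex.exp (-δ / 2 * x ^ 2 + c * x + 0) := by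
    intro x
    simp only [gaussianPDFReal, Complex.real_smul, NNReal.coe_one, mul_one, sub_zero,
      Complex.ofReal_mul, Complex.ofReal_exp, mul_assoc, ← Complex.exp_add]
    congr 2
    push_cast
    ring
  simp_rw [e]
  rw [integral_const_mul, h, ← mul_assoc]
  congr 1
  · have : (Real.pi / -(-(δ : ℂ) / 2)) = ((2 * Real.pi / δ : ℝ) : ℂ) := by
      push_cast; field_simp
    rw [this, show (1 / 2 : ℂ) = ((1 / 2 : ℝ) : ℂ) by push_cast; rfl,
      ← Complex.ofReal_cpow (by positivity), ← Real.sqrt_eq_rpow, ← Complex.ofReal_mul,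
      Real.sqrt_div (by positivity)]
    congr 1
    field_simp
  · congr 1
    field_simp
    ring

theorem integral_stdGauss_cexp_quadratic {d : ℕ} (δ : Fin d → ℝ) (hδ : ∀ k, 0 < δ k)
    (c : Fin d → ℂ) :
    ∫ x : Fin d → ℝ, Complex.exp (∑ k, ((1 - δ k) / 2 * x k ^ 2 + c k * x k)) ∂stdGauss d
      = ((Real.sqrt (∏ k, δ k))⁻¹ : ℝ) * Complex.exp (∑ k, c k ^ 2 / (2 * δ k)) := by
  simp_rw [Complex.exp_sum]
  rw [integral_fintype_prod_eq_prod
    (f := fun k (x : ℝ) => Complex.exp ((1 - δ k) / 2 * x ^ 2 + c k * x))]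
  simp_rw [integral_gaussianReal_cexp_quadratic (hδ _)]
  rw [Finset.prod_mul_distrib, Real.sqrt_prod _ fun k _ => (hδ k).le]
  push_cast
  simp

theorem integral_stdGauss_cexp_linear {d : ℕ} (c : Fin d → ℂ) :
    ∫ x : Fin d → ℝ, Complex.exp (∑ k, c k * x k) ∂stdGauss d
      = Complex.exp (∑ k, c k ^ 2 / 2) := by
  simpa using integral_stdGauss_cexp_quadratic (fun _ : Fin d => 1) (fun _ => one_pos) c

theorem integrable_stdGauss_exp_sq (d : ℕ) :
    Integrable (fun x : Fin d → ℝ => Real.exp (1 / 4 * ∑ k, x k ^ 2)) (stdGauss d) := by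
  have h1 : Integrable (fun x : ℝ => Real.exp (1 / 4 * x ^ 2)) (gaussianReal 0 1) := by
    -- The integral is `√2 ≠ 0`, while a function that is not integrable has integral `0`.
    by_contra hn
    have h := integral_gaussianReal_cexp_quadratic (δ := 1 / 2) (by norm_num) 0
    have e : ∀ x : ℝ, Complex.exp ((1 - (1 / 2 : ℝ)) / 2 * x ^ 2 + 0 * x)
        = ((Real.exp (1 / 4 * x ^ 2) : ℝ) : ℂ) := by
      intro x; push_cast; congr 1; ring
    simp_rw [e, integral_complex_ofReal, integral_undef hn] at h
    simp at h
    exact absurd h.symm (by simp)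
  simp_rw [Finset.mul_sum, Real.exp_sum]
  exact Integrable.fintype_prod (f := fun (_ : Fin d) (x : ℝ) => Real.exp (1 / 4 * x ^ 2))
    (fun _ => h1)

theorem abs_mulVec_le {d : ℕ} (R : Matrix (Fin d) (Fin d) ℝ) (z : Fin d → ℝ) (k : Fin d) :
    |(R *ᵥ z) k| ≤ Real.sqrt ((R * Rᵀ) k k) * Real.sqrt (∑ j, z j ^ 2) := by
  have h := Finset.sum_mul_sq_le_sq_mul_sq Finset.univ (fun j => R k j) z
  rw [← Real.sqrt_mul' _ (Finset.sum_nonneg fun _ _ => sq_nonneg _)]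
  refine Real.abs_le_sqrt ?_
  simpa [Matrix.mulVec, dotProduct, Matrix.mul_apply, pow_two] using h

theorem ofReal_mulVec {d : ℕ} (R : Matrix (Fin d) (Fin d) ℝ) (z : Fin d → ℝ) (k : Fin d) :
    (((R *ᵥ z) k : ℝ) : ℂ) = ∑ j, (R k j : ℂ) * z j := by
  simp [Matrix.mulVec, dotProduct]

/-- The affine image `u + i R z` of the Gaussian variable `z`. -/
def affineC {d : ℕ} (R : Matrix (Fin d) (Fin d) ℝ) (u z : Fin d → ℝ) : Fin d → ℂ :=
  fun k => u k + Complex.I * ((R *ᵥ z) k : ℝ)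

theorem measurable_mulVec {d : ℕ} (R : Matrix (Fin d) (Fin d) ℝ) :
    Measurable fun z : Fin d → ℝ => R *ᵥ z :=
  (Continuous.matrix_mulVec continuous_const continuous_id).measurable

theorem measurable_affineC {d : ℕ} (R : Matrix (Fin d) (Fin d) ℝ) (u : Fin d → ℝ) :
    Measurable (affineC R u) := by
  refine measurable_pi_lambda _ fun k => ?_
  exact ((Complex.measurable_ofReal.comp
    ((measurable_pi_apply k).comp (measurable_mulVec R))).const_mul _).const_add _

theorem norm_affineC_le {d : ℕ} (R : Matrix (Fin d) (Fin d) ℝ) (u z : Fin d → ℝ) (k : Fin d) :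
    ‖affineC R u z k‖ ≤ |u k| + |(R *ᵥ z) k| := by
  refine (norm_add_le _ _).trans ?_
  simp

theorem integrable_exp_norm_affineC {d : ℕ} (R : Matrix (Fin d) (Fin d) ℝ) (u : Fin d → ℝ)
    (r : ℝ) :
    Integrable (fun z => Real.exp (r * ∑ k, ‖affineC R u z k‖)) (stdGauss d) := by
  have hm : Measurable fun z => Real.exp (r * ∑ k, ‖affineC R u z k‖) :=
    Real.measurable_exp.comp ((Finset.measurable_fun_sum _ fun k _ =>
      ((measurable_pi_apply k).comp (measurable_affineC R u)).norm).const_mul r)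
  set a := ∑ k, |u k|
  set b := ∑ k, Real.sqrt ((R * Rᵀ) k k)
  refine ((integrable_stdGauss_exp_sq d).const_mul (Real.exp (|r| * a + (|r| * b) ^ 2))).mono'
    hm.aestronglyMeasurable (Filter.Eventually.of_forall fun z => ?_)
  rw [Real.norm_eq_abs, Real.abs_exp, ← Real.exp_add]
  refine Real.exp_le_exp.2 ?_
  set s := Real.sqrt (∑ j, z j ^ 2) with hs
  have hs2 : s ^ 2 = ∑ j, z j ^ 2 := Real.sq_sqrt (Finset.sum_nonneg fun _ _ => sq_nonneg _)
  have h1 : ∑ k, ‖affineC R u z k‖ ≤ a + b * s := by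
    rw [Finset.sum_mul, ← Finset.sum_add_distrib]
    exact Finset.sum_le_sum fun k _ => (norm_affineC_le R u z k).trans
      (add_le_add le_rfl (abs_mulVec_le R z k))
  have h0 : 0 ≤ ∑ k, ‖affineC R u z k‖ := Finset.sum_nonneg fun _ _ => norm_nonneg _
  have h2 : r * ∑ k, ‖affineC R u z k‖ ≤ |r| * (a + b * s) :=
    (mul_le_mul_of_nonneg_right (le_abs_self r) h0).trans
      (mul_le_mul_of_nonneg_left h1 (abs_nonneg r))
  rw [← hs2]
  -- `|r| b s ≤ (|r| b)² + ¼s²`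
  nlinarith [sq_nonneg (|r| * b - s / 2)]

/-- The Fourier representation `c e^{⟨u, w⟩ - ½|Rᵀw|²} = c 𝔼 e^{⟨u + i R Z, w⟩}`, `Z` standard
Gaussian. -/
theorem isLaplace_gaussian {d : ℕ} (R : Matrix (Fin d) (Fin d) ℝ) (u : Fin d → ℝ) (c : ℝ) :
    IsLaplace (stdGauss d) (affineC R u) c (fun _ => 1)
      (fun w => c * Real.exp (u ⬝ᵥ w - 1 / 2 * ((Rᵀ *ᵥ w) ⬝ᵥ (Rᵀ *ᵥ w)))) := by
  refine ⟨measurable_const, ⟨1, 0, fun _ => by simp⟩, fun w => ?_⟩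
  have e : ∀ z : Fin d → ℝ, Complex.exp (∑ k, affineC R u z k * w k)
      = Complex.exp (∑ k, u k * w k) *
        Complex.exp (∑ j, (Complex.I * ((Rᵀ *ᵥ w) j : ℝ)) * z j) := by
    intro z
    rw [← Complex.exp_add]
    congr 1
    simp_rw [affineC, ofReal_mulVec, add_mul, Finset.sum_add_distrib, Finset.mul_sum,
      Finset.sum_mul]
    congr 1
    rw [Finset.sum_comm]
    refine Finset.sum_congr rfl fun j _ => Finset.sum_congr rfl fun k _ => ?_
    rw [Matrix.transpose_apply]; ring
  simp_rw [one_mul, e]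
  rw [integral_const_mul, integral_stdGauss_cexp_linear, ← Complex.exp_add]
  push_cast
  congr 2
  simp only [dotProduct, mul_pow, Complex.I_sq, Complex.ofReal_sum, Complex.ofReal_mul,
    Finset.mul_sum, sub_eq_add_neg, ← Finset.sum_neg_distrib]
  congr 1
  refine Finset.sum_congr rfl fun j _ => ?_
  ring

/-! ### The bilinear series of Gaussian moments -/

/-- For small weights `e` the exponent of the majorant is at most `L + ¼(|z|² + |z'|²)`, and the
exponential of that bound is integrable for the standard Gaussian measure. -/
theorem sum_mul_abs_le {d : ℕ} (R T : Matrix (Fin d) (Fin d) ℝ) (u e : Fin d → ℝ)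
    (he : ∀ k, 0 ≤ e k)
    (hsmall : ∑ k, e k * (Real.sqrt ((R * Rᵀ) k k) * Real.sqrt ((T * Tᵀ) k k)) ≤ 1 / 4) :
    ∃ L : ℝ, ∀ z z' : Fin d → ℝ,
      ∑ k, e k * ((|u k| + |(R *ᵥ z) k|) * |(T *ᵥ z') k|)
        ≤ L + (1 / 4 * ∑ j, z j ^ 2 + 1 / 4 * ∑ j, z' j ^ 2) := by
  set L := ∑ k, e k * (|u k| * Real.sqrt ((T * Tᵀ) k k)) with hL
  refine ⟨2 * L ^ 2, fun z z' => ?_⟩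
  set s := Real.sqrt (∑ j, z j ^ 2) with hs
  set s' := Real.sqrt (∑ j, z' j ^ 2) with hs'
  have hs2 : s ^ 2 = ∑ j, z j ^ 2 := Real.sq_sqrt (Finset.sum_nonneg fun _ _ => sq_nonneg _)
  have hs2' : s' ^ 2 = ∑ j, z' j ^ 2 := Real.sq_sqrt (Finset.sum_nonneg fun _ _ => sq_nonneg _)
  have h1 : ∑ k, e k * ((|u k| + |(R *ᵥ z) k|) * |(T *ᵥ z') k|)
      ≤ L * s' + (∑ k, e k * (Real.sqrt ((R * Rᵀ) k k) * Real.sqrt ((T * Tᵀ) k k))) * (s * s') := by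
    rw [hL, Finset.sum_mul, Finset.sum_mul, ← Finset.sum_add_distrib]
    refine Finset.sum_le_sum fun k _ => ?_
    have hR := abs_mulVec_le R z k
    have hT := abs_mulVec_le T z' k
    calc e k * ((|u k| + |(R *ᵥ z) k|) * |(T *ᵥ z') k|)
        ≤ e k * ((|u k| + Real.sqrt ((R * Rᵀ) k k) * s) * (Real.sqrt ((T * Tᵀ) k k) * s')) := by
          refine mul_le_mul_of_nonneg_left ?_ (he k)
          exact mul_le_mul (add_le_add le_rfl hR) hT (abs_nonneg _)
            (add_nonneg (abs_nonneg _) (by positivity))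
      _ = _ := by ring
  have hss : 0 ≤ s * s' := mul_nonneg (Real.sqrt_nonneg _) (Real.sqrt_nonneg _)
  have h2 := mul_le_mul_of_nonneg_right hsmall hss
  rw [← hs2, ← hs2']
  -- `¼ s s' ≤ ⅛(s² + s'²)` and `L s' ≤ 2L² + ⅛s'²`
  nlinarith [sq_nonneg (s - s'), sq_nonneg (2 * L - s' / 2), sq_nonneg s]

/-- The double Gaussian integral that results from exchanging the sum with the integrals. -/
theorem integral_prod_cexp {d : ℕ} (R T : Matrix (Fin d) (Fin d) ℝ) (u v e δ : Fin d → ℝ)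
    (hδ : ∀ k, 0 < δ k)
    (hK : Tᵀ * Matrix.diagonal e * (R * Rᵀ) * Matrix.diagonal e * T = 1 - Matrix.diagonal δ)
    (hint : Integrable (fun p : (Fin d → ℝ) × (Fin d → ℝ) => Complex.exp
      (∑ k, (e k * (affineC R u p.1 k * -affineC T 0 p.2 k) + affineC T 0 p.2 k * v k)))
      ((stdGauss d).prod (stdGauss d))) :
    ∫ p : (Fin d → ℝ) × (Fin d → ℝ), Complex.exp
      (∑ k, (e k * (affineC R u p.1 k * -affineC T 0 p.2 k) + affineC T 0 p.2 k * v k))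
      ∂(stdGauss d).prod (stdGauss d)
    = ((Real.sqrt (∏ k, δ k))⁻¹ * Real.exp
        (-(1 / 2) * ∑ k, (Tᵀ *ᵥ (v - Matrix.diagonal e *ᵥ u)) k ^ 2 / δ k) : ℝ) := by
  rw [integral_prod_symm _ hint]
  set K : Matrix (Fin d) (Fin d) ℝ := Rᵀ * Matrix.diagonal e * T with hKdef
  set a := Tᵀ *ᵥ (v - Matrix.diagonal e *ᵥ u) with ha
  -- For fixed `z'` the exponent is linear in `z` with coefficients `K z'`, so the inner integral is
  -- `exp(½|K z'|²)`, which is diagonal in `z'`.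
  have hKK : Kᵀ * K = 1 - Matrix.diagonal δ := by
    rw [← hK, hKdef]
    simp [Matrix.mul_assoc]
  have h1 : ∀ z' z : Fin d → ℝ, Complex.exp
      (∑ k, (e k * (affineC R u z k * -affineC T 0 z' k) + affineC T 0 z' k * v k))
      = Complex.exp (∑ k, Complex.I * (a k) * z' k) *
        Complex.exp (∑ j, ((K *ᵥ z') j : ℝ) * z j) := by
    intro z' z
    rw [← Complex.exp_add]
    congr 1
    have ea : ∑ k, Complex.I * (a k) * z' k
        = ∑ k, Complex.I * ((T *ᵥ z') k : ℝ) * ((v k : ℂ) - e k * u k) := by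
      have : a ⬝ᵥ z' = (T *ᵥ z') ⬝ᵥ (v - Matrix.diagonal e *ᵥ u) := by
        rw [ha, Matrix.mulVec_transpose, ← Matrix.dotProduct_mulVec, dotProduct_comm]
      have := congrArg (fun x : ℝ => Complex.I * x) this
      simpa [dotProduct, Matrix.mulVec_diagonal, Finset.mul_sum, mul_assoc] using this
    have eK : ∑ j, (((K *ᵥ z') j : ℝ) : ℂ) * z j
        = ∑ k, (e k : ℂ) * ((R *ᵥ z) k : ℝ) * ((T *ᵥ z') k : ℝ) := by
      have : (K *ᵥ z') ⬝ᵥ z = (Matrix.diagonal e *ᵥ (T *ᵥ z')) ⬝ᵥ (R *ᵥ z) := by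
        rw [hKdef, ← Matrix.mulVec_mulVec, ← Matrix.mulVec_mulVec, Matrix.mulVec_transpose,
          ← Matrix.dotProduct_mulVec]
      have := congrArg (fun x : ℝ => (x : ℂ)) this
      simp only [dotProduct, Matrix.mulVec_diagonal, Complex.ofReal_sum, Complex.ofReal_mul] at this
      rw [this]
      exact Finset.sum_congr rfl fun k _ => by ring
    rw [ea, eK, ← Finset.sum_add_distrib]
    refine Finset.sum_congr rfl fun k _ => ?_
    simp only [affineC, Pi.zero_apply, Complex.ofReal_zero, zero_add]
    linear_combination (-(e k : ℂ) * ((R *ᵥ z) k : ℝ) * ((T *ᵥ z') k : ℝ)) * Complex.I_sq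
  have h2 : ∀ z' : Fin d → ℝ, Complex.exp (∑ k, Complex.I * (a k) * z' k) *
      Complex.exp (∑ j, (((K *ᵥ z') j : ℝ) : ℂ) ^ 2 / 2)
      = Complex.exp (∑ k, ((1 - δ k) / 2 * z' k ^ 2 + (Complex.I * a k) * z' k)) := by
    intro z'
    have : (K *ᵥ z') ⬝ᵥ (K *ᵥ z') = z' ⬝ᵥ ((1 - Matrix.diagonal δ) *ᵥ z') := by
      rw [← hKK, dotProduct_comm z', ← Matrix.mulVec_mulVec z' Kᵀ K, Matrix.mulVec_transpose,
        ← Matrix.dotProduct_mulVec]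
    have := congrArg (fun x : ℝ => (x : ℂ)) this
    simp only [dotProduct, Matrix.sub_mulVec, Matrix.one_mulVec, Pi.sub_apply,
      Matrix.mulVec_diagonal, Complex.ofReal_sum, Complex.ofReal_mul, Complex.ofReal_sub] at this
    have e2 : ∑ j, (((K *ᵥ z') j : ℝ) : ℂ) ^ 2 / 2 = ∑ k, (1 - (δ k : ℂ)) / 2 * z' k ^ 2 := by
      rw [← Finset.sum_div]
      simp_rw [pow_two]
      rw [this, Finset.sum_div]
      exact Finset.sum_congr rfl fun k _ => by ring
    rw [← Complex.exp_add, e2, Finset.sum_add_distrib, add_comm]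
  simp_rw [h1, integral_const_mul, integral_stdGauss_cexp_linear, h2]
  rw [integral_stdGauss_cexp_quadratic δ hδ]
  push_cast
  congr 2
  rw [Finset.mul_sum]
  refine Finset.sum_congr rfl fun k _ => ?_
  rw [mul_pow, Complex.I_sq, mul_comm (2 : ℂ), ← div_div]
  ring

/-- The bilinear series of the Gaussian moments of `u + iRZ` and `-iTZ'` with the weights `eⁿ / n!`.
The sum and the expectations are exchanged by dominated convergence on the product space, and
`hsmall` makes the majorant integrable. -/
theorem hasSum_integral_mul_integral {d : ℕ} (R T : Matrix (Fin d) (Fin d) ℝ)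
    (u v e δ : Fin d → ℝ) (he : ∀ k, 0 ≤ e k)
    (hsmall : ∑ k, e k * (Real.sqrt ((R * Rᵀ) k k) * Real.sqrt ((T * Tᵀ) k k)) ≤ 1 / 4)
    (hδ : ∀ k, 0 < δ k)
    (hK : Tᵀ * Matrix.diagonal e * (R * Rᵀ) * Matrix.diagonal e * T = 1 - Matrix.diagonal δ) :
    HasSum (fun n : Fin d → ℕ => ((∏ k, e k ^ n k / (n k).factorial : ℝ) : ℂ) * (-1) ^ (∑ k, n k) *
      ((∫ z, ∏ k, affineC R u z k ^ n k ∂stdGauss d) *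
        ∫ z', (∏ k, affineC T 0 z' k ^ n k) * Complex.exp (∑ k, affineC T 0 z' k * v k)
          ∂stdGauss d))
      ((Real.sqrt (∏ k, δ k))⁻¹ * Real.exp
        (-(1 / 2) * ∑ k, (Tᵀ *ᵥ (v - Matrix.diagonal e *ᵥ u)) k ^ 2 / δ k) : ℝ) := by
  obtain ⟨L, hL⟩ := sum_mul_abs_le R T u e he hsmall
  have hAm : ∀ (R : Matrix (Fin d) (Fin d) ℝ) (u : Fin d → ℝ) (k : Fin d),
      Measurable fun z => affineC R u z k :=
    fun R u k => (measurable_pi_apply k).comp (measurable_affineC R u)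
  have hexp : Measurable fun z' : Fin d → ℝ => Complex.exp (∑ k, affineC T 0 z' k * v k) :=
    Complex.measurable_exp.comp (Finset.measurable_fun_sum _ fun k _ => (hAm T 0 k).mul_const _)
  have hnexp : ∀ z' : Fin d → ℝ, ‖Complex.exp (∑ k, affineC T 0 z' k * v k)‖ = 1 := by
    intro z'
    rw [Complex.norm_exp]
    simp [affineC]
  set x : (Fin d → ℝ) × (Fin d → ℝ) → Fin d → ℂ :=
    fun p k => e k * (affineC R u p.1 k * -affineC T 0 p.2 k) with hx
  have hxm : ∀ k, Measurable fun p => x p k := fun k =>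
    (((hAm R u k).comp measurable_fst).mul ((hAm T 0 k).comp measurable_snd).neg).const_mul _
  have hxle : ∀ p k, ‖x p k‖ ≤ e k * ((|u k| + |(R *ᵥ p.1) k|) * |(T *ᵥ p.2) k|) := by
    intro p k
    simp only [hx, norm_mul, norm_neg, Complex.norm_real, Real.norm_eq_abs, abs_of_nonneg (he k)]
    refine mul_le_mul_of_nonneg_left (mul_le_mul (norm_affineC_le R u p.1 k) ?_ (norm_nonneg _)
      (by positivity)) (he k)
    simpa using norm_affineC_le T 0 p.2 k
  have hbd : Integrable (fun p : (Fin d → ℝ) × (Fin d → ℝ) => Real.exp (∑ k, ‖x p k‖))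
      ((stdGauss d).prod (stdGauss d)) := by
    refine (((integrable_stdGauss_exp_sq d).mul_prod (integrable_stdGauss_exp_sq d)).const_mul
      (Real.exp L)).mono' ?_ (Filter.Eventually.of_forall fun p => ?_)
    · exact (Real.measurable_exp.comp
        (Finset.measurable_fun_sum _ fun k _ => (hxm k).norm)).aestronglyMeasurable
    · rw [Real.norm_eq_abs, Real.abs_exp, ← Real.exp_add, ← Real.exp_add]
      exact Real.exp_le_exp.2 ((Finset.sum_le_sum fun k _ => hxle p k).trans (hL p.1 p.2))
  have hreal := fun p => hasSum_prod_pow_div_factorial_real (fun k => ‖x p k‖)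
    fun k => norm_nonneg _
  have hF : ∀ n : Fin d → ℕ, Measurable fun p : (Fin d → ℝ) × (Fin d → ℝ) =>
      (∏ k, x p k ^ n k / (n k).factorial) * Complex.exp (∑ k, affineC T 0 p.2 k * v k) :=
    fun n => (Finset.measurable_fun_prod _ fun k _ => ((hxm k).pow_const _).div_const _).mul
      (hexp.comp measurable_snd)
  have key := hasSum_integral_of_dominated_convergence
    (μ := (stdGauss d).prod (stdGauss d))
    (F := fun (n : Fin d → ℕ) p =>
      (∏ k, x p k ^ n k / (n k).factorial) * Complex.exp (∑ k, affineC T 0 p.2 k * v k))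
    (f := fun p => Complex.exp (∑ k, x p k) * Complex.exp (∑ k, affineC T 0 p.2 k * v k))
    (fun n p => ∏ k, ‖x p k‖ ^ n k / (n k).factorial)
    (fun n => (hF n).aestronglyMeasurable)
    (fun n => Filter.Eventually.of_forall fun p => by
      rw [norm_mul, hnexp, mul_one, norm_prod]
      simp)
    (Filter.Eventually.of_forall fun p => (hreal p).summable)
    (by simpa only [(hreal _).tsum_eq] using hbd)
    (Filter.Eventually.of_forall fun p =>
      (hasSum_prod_pow_div_factorial (x p)).mul_right _)
  simp_rw [← Complex.exp_add, ← Finset.sum_add_distrib] at key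
  rw [integral_prod_cexp R T u v e δ hδ hK] at key
  · refine Eq.mp (congrArg (HasSum · _) (funext fun n => ?_)) key
    rw [← integral_prod_mul, ← integral_const_mul]
    refine integral_congr_ae (Filter.Eventually.of_forall fun p => ?_)
    simp only [hx, mul_pow, Finset.prod_mul_distrib, Finset.prod_div_distrib, neg_pow (affineC _ _ _ _),
      Finset.prod_pow_eq_pow_sum, Complex.ofReal_prod, Complex.ofReal_div, Complex.ofReal_pow,
      Complex.ofReal_natCast]
    ring
  · refine hbd.mono' ?_ (Filter.Eventually.of_forall fun p => ?_)
    · refine (Complex.measurable_exp.comp (Finset.measurable_fun_sum _ fun k _ =>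
        (hxm k).add (((hAm T 0 k).comp measurable_snd).mul_const _))).aestronglyMeasurable
    · rw [Finset.sum_add_distrib, Complex.exp_add, norm_mul, hnexp, mul_one]
      exact (Complex.norm_exp_le_exp_norm _).trans (Real.exp_le_exp.2 (norm_sum_le _ _))

/-! ### Positive definite matrices -/

theorem exists_orthogonal_diagonal {d : ℕ} {S : Matrix (Fin d) (Fin d) ℝ} (hS : S.PosDef) :
    ∃ (O : Matrix (Fin d) (Fin d) ℝ) (s : Fin d → ℝ), Oᵀ * O = 1 ∧ (∀ k, 0 < s k) ∧
      Oᵀ * S * O = Matrix.diagonal s := by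
  have hH := hS.isHermitian
  refine ⟨hH.eigenvectorUnitary, hH.eigenvalues, ?_, hS.eigenvalues_pos, ?_⟩
  · have := Unitary.coe_star_mul_self hH.eigenvectorUnitary
    rwa [Matrix.star_eq_conjTranspose, Matrix.conjTranspose_eq_transpose_of_trivial] at this
  · have := hH.conjStarAlgAut_star_eigenvectorUnitary
    rw [Unitary.conjStarAlgAut_apply] at this
    simpa [Matrix.star_eq_conjTranspose, Matrix.conjTranspose_eq_transpose_of_trivial,
      Function.comp_def] using this

theorem isUnit_of_transpose_mul_mul_eq_one {d : ℕ} {S T : Matrix (Fin d) (Fin d) ℝ}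
    (h : Tᵀ * S * T = 1) : IsUnit T :=
  IsUnit.of_mul_eq_one_right _ h

/-- Simultaneous diagonalization of two positive definite quadratic forms. -/
theorem exists_simultaneous_diagonalization {d : ℕ} {S P : Matrix (Fin d) (Fin d) ℝ}
    (hS : S.PosDef) (hP : P.PosDef) :
    ∃ (T : Matrix (Fin d) (Fin d) ℝ) (δ : Fin d → ℝ), (∀ k, 0 < δ k) ∧ IsUnit T ∧
      Tᵀ * S * T = 1 ∧ Tᵀ * P * T = Matrix.diagonal δ := by
  obtain ⟨O, s, hO, hs, hOS⟩ := exists_orthogonal_diagonal hS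
  set r : Matrix (Fin d) (Fin d) ℝ := Matrix.diagonal fun k => (Real.sqrt (s k))⁻¹ with hr
  have h0 : (O * r)ᵀ * S * (O * r) = 1 := by
    have : (O * r)ᵀ * S * (O * r) = r * (Oᵀ * S * O) * r := by
      rw [Matrix.transpose_mul, hr, Matrix.diagonal_transpose]
      simp only [Matrix.mul_assoc]
    rw [this, hOS, hr, Matrix.diagonal_mul_diagonal, Matrix.diagonal_mul_diagonal,
      ← Matrix.diagonal_one]
    congr 1
    funext k
    have h1 := Real.sqrt_pos.2 (hs k)
    have h2 := Real.mul_self_sqrt (hs k).le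
    field_simp
    nlinarith
  have hu := isUnit_of_transpose_mul_mul_eq_one h0
  have hW : ((O * r)ᵀ * P * (O * r)).PosDef := by
    have := (Matrix.IsUnit.posDef_star_left_conjugate_iff hu).2 hP
    simpa [Matrix.star_eq_conjTranspose] using this
  obtain ⟨O', δ, hO', hδ, hOW⟩ := exists_orthogonal_diagonal hW
  have hS' : (O * r * O')ᵀ * S * (O * r * O') = 1 := by
    have : (O * r * O')ᵀ * S * (O * r * O') = O'ᵀ * ((O * r)ᵀ * S * (O * r)) * O' := by
      rw [Matrix.transpose_mul (O * r)]
      simp only [Matrix.mul_assoc]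
    rw [this, h0, Matrix.mul_one, hO']
  refine ⟨O * r * O', δ, hδ, isUnit_of_transpose_mul_mul_eq_one hS', hS', ?_⟩
  rw [← hOW, Matrix.transpose_mul (O * r)]
  simp only [Matrix.mul_assoc]

theorem spectrum_pos_of_posDef {d : ℕ} {S : Matrix (Fin d) (Fin d) ℝ} (hS : S.PosDef) {r : ℝ}
    (hr : r ∈ spectrum ℝ S) : 0 < r := by
  rw [hS.isHermitian.spectrum_real_eq_range_eigenvalues] at hr
  obtain ⟨i, rfl⟩ := hr
  exact hS.eigenvalues_pos i

theorem posSemidef_integral {d : ℕ} {ν : Measure ℝ} {F : ℝ → Matrix (Fin d) (Fin d) ℝ}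
    (hF : ∀ s, (F s).PosSemidef) (hint : ∀ i j, Integrable (fun s => F s i j) ν) :
    (Matrix.of fun i j => ∫ s, F s i j ∂ν).PosSemidef := by
  refine .of_dotProduct_mulVec_nonneg ?_ fun x => ?_
  · ext i j
    simp only [Matrix.conjTranspose_apply, Matrix.of_apply, star_trivial]
    refine integral_congr_ae (Filter.Eventually.of_forall fun s => ?_)
    simpa using (hF s).isHermitian.apply i j
  · have : star x ⬝ᵥ ((Matrix.of fun i j => ∫ s, F s i j ∂ν) *ᵥ x)
        = ∫ s, star x ⬝ᵥ (F s *ᵥ x) ∂ν := by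
      simp only [dotProduct, Matrix.mulVec, Matrix.of_apply]
      rw [integral_finsetSum _ fun i _ => Integrable.const_mul
        (integrable_finsetSum _ fun j _ => (hint i j).mul_const _) _]
      refine Finset.sum_congr rfl fun i _ => ?_
      rw [integral_const_mul, integral_finsetSum _ fun j _ => (hint i j).mul_const _]
      simp_rw [integral_mul_const]
    rw [this]
    exact integral_nonneg fun s => (hF s).dotProduct_mulVec_nonneg x

/-! ### The covariance matrices -/

section Covariance

variable {d : ℕ} {Q B M : Matrix (Fin d) (Fin d) ℝ} {l : Fin d → ℝ}

/-- The numbers `-l_k` are eigenvalues of `B`, so stability of `B` makes the `l_k` positive. -/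
theorem diagonal_pos_of_spectrum (hB : ∀ z ∈ spectrum ℂ (B.map (algebraMap ℝ ℂ)), z.re < 0)
    (hM : IsUnit M) (hdiag : M * B * M⁻¹ = -Matrix.diagonal l) (k : Fin d) : 0 < l k := by
  have hMd : IsUnit M.det := (Matrix.isUnit_iff_isUnit_det M).1 hM
  -- `M(-l_k - B)M⁻¹ = diag(l_j - l_k)` is singular.
  have hdet : (algebraMap ℝ _ (-l k) - B : Matrix (Fin d) (Fin d) ℝ).det = 0 := by
    have h1 : M * (algebraMap ℝ _ (-l k) - B) * M⁻¹ = Matrix.diagonal fun j => l j - l k := by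
      rw [Matrix.mul_sub, Matrix.sub_mul, hdiag, Algebra.algebraMap_eq_smul_one, Matrix.mul_smul,
        Matrix.mul_one, Matrix.smul_mul, Matrix.mul_nonsing_inv _ hMd, ← Matrix.diagonal_one]
      ext i j
      by_cases h : i = j
      · subst h; simp; ring
      · simp [h]
    have h2 := congrArg Matrix.det h1
    rw [Matrix.det_conj hM, Matrix.det_diagonal,
      Finset.prod_eq_zero (Finset.mem_univ k) (sub_self _)] at h2
    exact h2
  have hmem : ((-l k : ℝ) : ℂ) ∈ spectrum ℂ (B.map (algebraMap ℝ ℂ)) := by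
    rw [spectrum.mem_iff, Matrix.isUnit_iff_isUnit_det]
    have : (algebraMap ℂ (Matrix (Fin d) (Fin d) ℂ) ((-l k : ℝ) : ℂ) - B.map (algebraMap ℝ ℂ))
        = (algebraMap ℝ _ (-l k) - B : Matrix (Fin d) (Fin d) ℝ).map (algebraMap ℝ ℂ) := by
      ext i j
      by_cases h : i = j
      · subst h; simp [Matrix.algebraMap_matrix_apply]
      · simp [Matrix.algebraMap_matrix_apply, h]
    rw [this, ← RingHom.mapMatrix_apply, ← RingHom.map_det, hdet]
    simp
  have := hB _ hmem
  simpa using this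

theorem exp_smul_eq_conj (hM : IsUnit M) (hdiag : M * B * M⁻¹ = -Matrix.diagonal l) (t : ℝ) :
    NormedSpace.exp (t • B) = M⁻¹ * Matrix.diagonal (fun k => Real.exp (-t * l k)) * M := by
  have hMd : IsUnit M.det := (Matrix.isUnit_iff_isUnit_det M).1 hM
  have hB : t • B = M⁻¹ * Matrix.diagonal (fun k => -t * l k) * M := by
    have h1 : Matrix.diagonal (fun k => -t * l k) = t • (M * B * M⁻¹) := by
      rw [hdiag]
      ext i j
      by_cases h : i = j
      · subst h; simp
      · simp [h]
    rw [h1, Matrix.mul_smul, Matrix.smul_mul]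
    congr 1
    rw [Matrix.mul_assoc M, Matrix.nonsing_inv_mul_cancel_left _ _ hMd, Matrix.mul_assoc,
      Matrix.nonsing_inv_mul _ hMd, Matrix.mul_one]
  rw [hB, Matrix.exp_conj' _ _ hM, Matrix.exp_diagonal]
  congr 3
  funext k
  rw [Pi.exp_def]
  exact (congrFun Real.exp_eq_exp_ℝ _).symm

theorem exp_smul_transpose (t : ℝ) :
    NormedSpace.exp (t • Bᵀ) = (NormedSpace.exp (t • B))ᵀ := by
  rw [← Matrix.transpose_smul, Matrix.exp_transpose]

/-- The integrand `e^{sB} Q e^{sB*}` of the covariance matrices. -/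
def covIntegrand (Q B : Matrix (Fin d) (Fin d) ℝ) (s : ℝ) : Matrix (Fin d) (Fin d) ℝ :=
  NormedSpace.exp (s • B) * Q * NormedSpace.exp (s • Bᵀ)

theorem posSemidef_covIntegrand (hQ : Q.PosSemidef) (s : ℝ) :
    (covIntegrand Q B s).PosSemidef := by
  have := hQ.mul_mul_conjTranspose_same (NormedSpace.exp (s • B))
  rwa [Matrix.conjTranspose_eq_transpose_of_trivial, ← exp_smul_transpose] at this

theorem covIntegrand_add (s t : ℝ) :
    covIntegrand Q B (t + s)
      = NormedSpace.exp (t • B) * covIntegrand Q B s * NormedSpace.exp (t • Bᵀ) := by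
  have h : ∀ B : Matrix (Fin d) (Fin d) ℝ,
      NormedSpace.exp ((t + s) • B) = NormedSpace.exp (t • B) * NormedSpace.exp (s • B) := by
    intro B
    rw [add_smul]
    exact Matrix.exp_add_of_commute _ _ ((Commute.refl B).smul_left t |>.smul_right s)
  have h' : NormedSpace.exp ((t + s) • Bᵀ)
      = NormedSpace.exp (s • Bᵀ) * NormedSpace.exp (t • Bᵀ) := by
    rw [add_comm, add_smul]
    exact Matrix.exp_add_of_commute _ _ ((Commute.refl Bᵀ).smul_left s |>.smul_right t)
  rw [covIntegrand, h, h', covIntegrand]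
  simp only [Matrix.mul_assoc]

theorem mul_mul_apply_eq_sum (X F Y : Matrix (Fin d) (Fin d) ℝ) (i j : Fin d) :
    (X * F * Y) i j = ∑ p : Fin d × Fin d, (X i p.1 * Y p.2 j) * F p.1 p.2 := by
  rw [Matrix.mul_apply, Fintype.sum_prod_type_right]
  refine Finset.sum_congr rfl fun m _ => ?_
  rw [Matrix.mul_apply, Finset.sum_mul]
  exact Finset.sum_congr rfl fun k _ => by ring

/-- Conjugation by `M` turns the entries of the integrand into multiples of `e^{-(l_k + l_m)s}`. -/
theorem integrableOn_covIntegrand (hl : ∀ k, 0 < l k) (hM : IsUnit M)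
    (hdiag : M * B * M⁻¹ = -Matrix.diagonal l) (i j : Fin d) :
    IntegrableOn (fun s => covIntegrand Q B s i j) (Set.Ioi 0) := by
  have h : ∀ s, covIntegrand Q B s = M⁻¹ * (Matrix.of fun k m =>
      Real.exp (-(l k + l m) * s) * (M * Q * Mᵀ) k m) * (M⁻¹)ᵀ := by
    intro s
    have : (Matrix.of fun k m => Real.exp (-(l k + l m) * s) * (M * Q * Mᵀ) k m)
        = Matrix.diagonal (fun k => Real.exp (-s * l k)) * (M * Q * Mᵀ) *
          Matrix.diagonal (fun k => Real.exp (-s * l k)) := by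
      ext k m
      rw [Matrix.mul_diagonal, Matrix.diagonal_mul, Matrix.of_apply, mul_right_comm,
        ← Real.exp_add]
      congr 2
      ring
    rw [this, covIntegrand, exp_smul_transpose, exp_smul_eq_conj hM hdiag]
    simp only [Matrix.transpose_mul, Matrix.diagonal_transpose, Matrix.mul_assoc]
  simp_rw [h, mul_mul_apply_eq_sum M⁻¹]
  refine integrable_finsetSum _ fun p _ => Integrable.const_mul ?_ _
  exact (exp_neg_integrableOn_Ioi 0 (add_pos (hl p.1) (hl p.2))).mul_const _

/-- The stationarity identity `Q_∞ = Q_t + e^{tB} Q_∞ e^{tB*}`. -/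
theorem Qinf_eq_add {t : ℝ} (ht : 0 < t)
    (hint : ∀ i j, IntegrableOn (fun s => covIntegrand Q B s i j) (Set.Ioi 0)) :
    Qinf Q B = Qt Q B t +
      NormedSpace.exp (t • B) * Qinf Q B * (NormedSpace.exp (t • B))ᵀ := by
  ext i j
  have h1 : ∫ s in Set.Ioi t, covIntegrand Q B s i j
      = (NormedSpace.exp (t • B) * Qinf Q B * (NormedSpace.exp (t • B))ᵀ) i j := by
    have hpre : (fun s => t + s) ⁻¹' Set.Ioi t = Set.Ioi 0 := by ext s; simp
    rw [← (measurePreserving_add_left volume t).setIntegral_preimage_emb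
      (measurableEmbedding_addLeft t), hpre]
    simp_rw [covIntegrand_add, mul_mul_apply_eq_sum (NormedSpace.exp (t • B))]
    rw [integral_finsetSum _ fun p _ => (hint p.1 p.2).const_mul _]
    simp_rw [integral_const_mul, exp_smul_transpose]
    rfl
  rw [Matrix.add_apply, ← h1]
  exact (intervalIntegral.integral_interval_add_Ioi (hint i j)
    ((hint i j).mono_set (Set.Ioi_subset_Ioi ht.le))).symm

theorem posDef_Qt (hQ : Q.PosSemidef)
    (hint : ∀ i j, IntegrableOn (fun s => covIntegrand Q B s i j) (Set.Ioi 0)) {t : ℝ}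
    (ht : 0 < t) (hdet : 0 < (Qt Q B t).det) : (Qt Q B t).PosDef := by
  have h : (Qt Q B t).PosSemidef := by
    have := posSemidef_integral (ν := volume.restrict (Set.Ioc 0 t))
      (posSemidef_covIntegrand (B := B) hQ)
      fun i j => (hint i j).mono_set Set.Ioc_subset_Ioi_self
    convert this using 1
    ext i j
    exact intervalIntegral.integral_of_le ht.le
  exact h.posDef_iff_det_ne_zero.2 hdet.ne'

theorem posDef_Qinf (hQ : Q.PosSemidef)
    (hint : ∀ i j, IntegrableOn (fun s => covIntegrand Q B s i j) (Set.Ioi 0))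
    (hdet : ∀ t : ℝ, 0 < t → 0 < (Qt Q B t).det) : (Qinf Q B).PosDef := by
  have h : (Qinf Q B).PosSemidef := posSemidef_integral (posSemidef_covIntegrand hQ) hint
  rw [Qinf_eq_add one_pos hint]
  refine (posDef_Qt hQ hint one_pos (hdet 1 one_pos)).add_posSemidef ?_
  simpa [Matrix.conjTranspose_eq_transpose_of_trivial] using
    h.mul_mul_conjTranspose_same (NormedSpace.exp ((1 : ℝ) • B))

end Covariance

/-! ### Eigenfunctions, co-eigenfunctions and the kernel -/

variable {d : ℕ}

theorem mulVec_transpose_dotProduct_self (R : Matrix (Fin d) (Fin d) ℝ) (z : Fin d → ℝ) :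
    (Rᵀ *ᵥ z) ⬝ᵥ (Rᵀ *ᵥ z) = ((R * Rᵀ) *ᵥ z) ⬝ᵥ z := by
  rw [← Matrix.mulVec_mulVec, Matrix.dotProduct_mulVec, Matrix.vecMul_transpose]

theorem conj_mulVec_dotProduct (S A : Matrix (Fin d) (Fin d) ℝ) (z : Fin d → ℝ) :
    ((A * S * Aᵀ) *ᵥ z) ⬝ᵥ z = (S *ᵥ (Aᵀ *ᵥ z)) ⬝ᵥ (Aᵀ *ᵥ z) := by
  rw [Matrix.mul_assoc, ← Matrix.mulVec_mulVec, dotProduct_comm, Matrix.dotProduct_mulVec,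
    ← Matrix.mulVec_transpose, dotProduct_comm, Matrix.mulVec_mulVec]

theorem genFun_eq (Q B M R : Matrix (Fin d) (Fin d) ℝ) (l : Fin d → ℝ) (ϱ : ℝ)
    (hR : R * Rᵀ = (scaling l ϱ * M) * Qinf Q B * (scaling l ϱ * M)ᵀ) (x z : Fin d → ℝ) :
    genFun Q B M l ϱ x z = Real.exp (((scaling l ϱ * M) *ᵥ x) ⬝ᵥ z -
      1 / 2 * ((Rᵀ *ᵥ z) ⬝ᵥ (Rᵀ *ᵥ z))) := by
  have hD : (scaling l ϱ)ᵀ = scaling l ϱ := Matrix.diagonal_transpose _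
  have h1 : (M *ᵥ x) ⬝ᵥ (scaling l ϱ *ᵥ z) = ((scaling l ϱ * M) *ᵥ x) ⬝ᵥ z := by
    rw [Matrix.dotProduct_mulVec, ← Matrix.mulVec_transpose, hD, Matrix.mulVec_mulVec]
  have h2 : Mᵀ *ᵥ (scaling l ϱ *ᵥ z) = (scaling l ϱ * M)ᵀ *ᵥ z := by
    rw [Matrix.transpose_mul, hD, Matrix.mulVec_mulVec]
  rw [genFun, h1, h2, mulVec_transpose_dotProduct_self, hR, conj_mulVec_dotProduct]

/-- `√n! H_n(x) = 𝔼 (u + iRZ)ⁿ` with `u = DMx`, for any square root `R` of the covariance matrix of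
`DMX`, `X ~ μ`. -/
theorem ofReal_eigenfun (Q B M R : Matrix (Fin d) (Fin d) ℝ) (l : Fin d → ℝ) (ϱ : ℝ)
    (hR : R * Rᵀ = (scaling l ϱ * M) * Qinf Q B * (scaling l ϱ * M)ᵀ) (n : Fin d → ℕ)
    (x : Fin d → ℝ) :
    (eigenfun Q B M l ϱ n x : ℂ) =
      (∫ z, ∏ k, affineC R ((scaling l ϱ * M) *ᵥ x) z k ^ n k ∂stdGauss d) /
        (Real.sqrt (multiFactorial n) : ℝ) := by
  have h := isLaplace_gaussian R ((scaling l ϱ * M) *ᵥ x) 1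
  simp only [one_mul, ← genFun_eq Q B M R l ϱ hR] at h
  have h2 := (h.multiD (measurable_affineC R _) (integrable_exp_norm_affineC R _) n).eq 0
  rw [eigenfun, Complex.ofReal_div, h2]
  simp

/-- `√n! G_n(y) μ(y) = (-1)^{|n|} c 𝔼 (iTZ)ⁿ e^{i⟨TZ, v⟩}` with `v = DMy` and `c` the normalizing
constant of `μ`, which cancels. -/
theorem ofReal_coeigenfun (Q B M T : Matrix (Fin d) (Fin d) ℝ) (l : Fin d → ℝ) (ϱ : ℝ)
    (hdet : 0 < (Qinf Q B).det)
    (hT : T * Tᵀ = ((scaling l ϱ * M)⁻¹)ᵀ * (Qinf Q B)⁻¹ * (scaling l ϱ * M)⁻¹)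
    (n : Fin d → ℕ) (y : Fin d → ℝ) :
    (coeigenfun Q B M l ϱ n y : ℂ) =
      (-1) ^ (∑ k, n k) / (Real.sqrt (multiFactorial n) : ℝ) *
      ((Real.exp (1 / 2 * (((Qinf Q B)⁻¹ *ᵥ y) ⬝ᵥ y)) : ℝ) *
        ∫ z, (∏ k, affineC T 0 z k ^ n k) *
          Complex.exp (∑ k, affineC T 0 z k * (((scaling l ϱ * M) *ᵥ y) k : ℝ)) ∂stdGauss d) := by
  set A := scaling l ϱ * M with hAdef
  set c : ℝ := ((2 * Real.pi) ^ ((d : ℝ) / 2) * Real.sqrt (Qinf Q B).det)⁻¹ with hc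
  have hc0 : c ≠ 0 := by
    have := Real.sqrt_pos.2 hdet
    have := Real.pi_pos
    positivity
  have h := isLaplace_gaussian T 0 c
  have hfun : (fun w : Fin d → ℝ => c * Real.exp (0 ⬝ᵥ w - 1 / 2 * ((Tᵀ *ᵥ w) ⬝ᵥ (Tᵀ *ᵥ w))))
      = fun u => invDensity Q B (A⁻¹ *ᵥ u) := by
    funext w
    have := conj_mulVec_dotProduct (Qinf Q B)⁻¹ (A⁻¹)ᵀ w
    rw [Matrix.transpose_transpose, ← hT] at this
    rw [invDensity, ← this, mulVec_transpose_dotProduct_self, zero_dotProduct, zero_sub, neg_mul]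
  rw [hfun] at h
  have h2 := (h.multiD (measurable_affineC T _) (integrable_exp_norm_affineC T _) n).eq (A *ᵥ y)
  have hinv : (invDensity Q B y)⁻¹ = c⁻¹ * Real.exp (1 / 2 * (((Qinf Q B)⁻¹ *ᵥ y) ⬝ᵥ y)) := by
    rw [invDensity, mul_inv, ← Real.exp_neg, neg_mul, neg_neg]
  rw [coeigenfun, div_eq_mul_inv (multiD _ _ _), hinv, Complex.ofReal_mul, Complex.ofReal_mul, h2]
  push_cast
  have hc0' : (c : ℂ) ≠ 0 := by exact_mod_cast hc0
  field_simp

theorem exp_neg_mul_pairing (t : ℝ) (n : Fin d → ℕ) (l : Fin d → ℝ) :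
    Real.exp (-t * pairing n l) = ∏ k, Real.exp (-t * l k) ^ n k := by
  rw [pairing, Finset.mul_sum, Real.exp_sum]
  refine Finset.prod_congr rfl fun k _ => ?_
  rw [← Real.exp_nat_mul]
  congr 1
  ring

theorem exists_forall_sum_exp_mul_le (l c : Fin d → ℝ) (hl : ∀ k, 0 < l k) {ε : ℝ} (hε : 0 < ε) :
    ∃ t₀ : ℝ, 0 < t₀ ∧ ∀ t, t₀ < t → ∑ k, Real.exp (-t * l k) * c k ≤ ε := by
  have h : Filter.Tendsto (fun t : ℝ => ∑ k, Real.exp (-t * l k) * c k) Filter.atTop (nhds 0) := by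
    have : ∀ k ∈ Finset.univ, Filter.Tendsto (fun t : ℝ => Real.exp (-t * l k) * c k)
        Filter.atTop (nhds (0 * c k)) := fun k _ => by
      refine Filter.Tendsto.mul_const _ (Real.tendsto_exp_atBot.comp ?_)
      simp_rw [neg_mul]
      exact Filter.tendsto_neg_atTop_atBot.comp (Filter.tendsto_id.atTop_mul_const (hl k))
    simpa using tendsto_finsetSum _ this
  obtain ⟨t₁, h1⟩ := Filter.eventually_atTop.1 (h.eventually (ge_mem_nhds hε))
  exact ⟨max t₁ 1, by positivity, fun t ht => h1 t ((le_max_left _ _).trans ht.le)⟩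

/-- If `C` transforms `S` into the identity and `P` into `diag(δ)`, then `δ` expresses both the ratio
of the determinants and the quadratic form of `P⁻¹`; here `S = Q_∞` and `P = Q_t`. -/
theorem kernel_eq {S P C : Matrix (Fin d) (Fin d) ℝ} {δ : Fin d → ℝ} (hC : IsUnit C)
    (hδ : ∀ k, 0 < δ k) (hS : C * S * Cᵀ = 1) (hP : C * P * Cᵀ = Matrix.diagonal δ)
    (w : Fin d → ℝ) :
    (Real.sqrt (∏ k, δ k))⁻¹ = Real.sqrt (S.det / P.det) ∧
      ∑ k, (C *ᵥ w) k ^ 2 / δ k = (P⁻¹ *ᵥ w) ⬝ᵥ w := by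
  have hCd : IsUnit C.det := (Matrix.isUnit_iff_isUnit_det C).1 hC
  constructor
  · have h1 := congrArg Matrix.det hS
    have h2 := congrArg Matrix.det hP
    rw [Matrix.det_mul, Matrix.det_mul, Matrix.det_transpose, Matrix.det_one] at h1
    rw [Matrix.det_mul, Matrix.det_mul, Matrix.det_transpose, Matrix.det_diagonal] at h2
    have hpos : 0 < ∏ k, δ k := Finset.prod_pos fun k _ => hδ k
    rw [← Real.sqrt_inv]
    congr 1
    have hP0 : P.det ≠ 0 := by
      intro h
      rw [h] at h2
      simp at h2
      exact hpos.ne h2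
    rw [inv_eq_one_div, div_eq_div_iff hpos.ne' hP0]
    rw [← h2]
    linear_combination (-P.det) * h1
  · have hD : IsUnit (Matrix.diagonal δ).det := by
      rw [Matrix.det_diagonal]
      exact (Finset.prod_pos fun k _ => hδ k).ne'.isUnit
    have hinv : P⁻¹ = Cᵀ * Matrix.diagonal (fun k => (δ k)⁻¹) * C := by
      have hCt : IsUnit (Cᵀ).det := by rwa [Matrix.det_transpose]
      have hDD : Matrix.diagonal δ * Matrix.diagonal (fun k => (δ k)⁻¹) = 1 := by
        rw [Matrix.diagonal_mul_diagonal, ← Matrix.diagonal_one]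
        congr 1
        funext k
        exact mul_inv_cancel₀ (hδ k).ne'
      have hP' : P * Cᵀ = C⁻¹ * Matrix.diagonal δ := by
        rw [← hP, Matrix.mul_assoc C, Matrix.nonsing_inv_mul_cancel_left _ _ hCd]
      refine Matrix.inv_eq_right_inv ?_
      rw [← Matrix.mul_assoc, ← Matrix.mul_assoc, hP', Matrix.mul_assoc C⁻¹, hDD, Matrix.mul_one,
        Matrix.nonsing_inv_mul _ hCd]
    have := conj_mulVec_dotProduct (Matrix.diagonal fun k => (δ k)⁻¹) Cᵀ w
    rw [Matrix.transpose_transpose] at this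
    rw [hinv, this]
    simp only [dotProduct, Matrix.mulVec_diagonal]
    exact Finset.sum_congr rfl fun k _ => by ring

end OUMehler

end

theorem corollary3p7 {d : ℕ} [NeZero d] (Q B M : Matrix (Fin d) (Fin d) ℝ) (l : Fin d → ℝ) (ϱ : ℝ)
    (hQ : Q.PosSemidef)
    (hdet : ∀ t : ℝ, 0 < t → 0 < (OUMehler.Qt Q B t).det)
    (hB : ∀ z ∈ spectrum ℂ (B.map (algebraMap ℝ ℂ)), z.re < 0)
    (hM : IsUnit M)
    (hdiag : M * B * M⁻¹ = -Matrix.diagonal l)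
    (hl : Monotone l)
    (hϱ : IsLeast (spectrum ℝ (l 0 • (M * OUMehler.Qinf Q B * Mᵀ))) ϱ) :
    ∃ t₀ : ℝ, 0 < t₀ ∧ ∀ t : ℝ, t₀ < t → ∀ x y : Fin d → ℝ,
      HasSum
        (fun n : Fin d → ℕ => Real.exp (-t * OUMehler.pairing n l) *
          OUMehler.eigenfun Q B M l ϱ n x * OUMehler.coeigenfun Q B M l ϱ n y)
        (Real.sqrt ((OUMehler.Qinf Q B).det / (OUMehler.Qt Q B t).det) *
          Real.exp ((1 / 2) * (((OUMehler.Qinf Q B)⁻¹ *ᵥ y) ⬝ᵥ y) -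
            (1 / 2) * (((OUMehler.Qt Q B t)⁻¹ *ᵥ (NormedSpace.exp (t • B) *ᵥ x - y)) ⬝ᵥ
              (NormedSpace.exp (t • B) *ᵥ x - y)))) := by
  open OUMehler in
  have hlpos := diagonal_pos_of_spectrum hB hM hdiag
  have hint := integrableOn_covIntegrand (Q := Q) hlpos hM hdiag
  have hS := posDef_Qinf hQ hint hdet
  have hϱpos : 0 < ϱ := by
    refine spectrum_pos_of_posDef (Matrix.PosDef.smul ?_ (hlpos 0)) hϱ.1
    simpa [Matrix.star_eq_conjTranspose] using
      (Matrix.IsUnit.posDef_star_right_conjugate_iff hM).2 hS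
  set A := scaling l ϱ * M with hAdef
  have hDu : IsUnit (scaling l ϱ) := by
    rw [scaling, Matrix.isUnit_iff_isUnit_det, Matrix.det_diagonal]
    exact (Finset.prod_pos fun k _ => Real.sqrt_pos.2 (div_pos (hlpos k) hϱpos)).ne'.isUnit
  have hA : IsUnit A := hDu.mul hM
  have hAd : IsUnit A.det := (Matrix.isUnit_iff_isUnit_det A).1 hA
  obtain ⟨t₀, ht₀, hsmall⟩ := exists_forall_sum_exp_mul_le l (fun k =>
    Real.sqrt ((A * Qinf Q B * Aᵀ) k k) * Real.sqrt (((A⁻¹)ᵀ * (Qinf Q B)⁻¹ * A⁻¹) k k)) hlpos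
    (ε := 1 / 4) (by norm_num)
  refine ⟨t₀, ht₀, fun t ht x y => ?_⟩
  have htpos := ht₀.trans ht
  have hP := posDef_Qt hQ hint htpos (hdet t htpos)
  obtain ⟨T₀, δ, hδ, hT₀, hT₀S, hT₀P⟩ := exists_simultaneous_diagonalization hS hP
  set e : Fin d → ℝ := fun k => Real.exp (-t * l k) with he
  have hAexp : A * NormedSpace.exp (t • B) = Matrix.diagonal e * A := by
    have hMd : IsUnit M.det := (Matrix.isUnit_iff_isUnit_det M).1 hM
    rw [exp_smul_eq_conj hM hdiag, hAdef, Matrix.mul_assoc, ← Matrix.mul_assoc M,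
      Matrix.mul_nonsing_inv_cancel_left _ _ hMd, ← Matrix.mul_assoc, ← Matrix.mul_assoc, scaling,
      Matrix.diagonal_mul_diagonal, Matrix.diagonal_mul_diagonal]
    congr 2
    funext k
    exact mul_comm _ _
  have hTd : IsUnit T₀.det := (Matrix.isUnit_iff_isUnit_det T₀).1 hT₀
  have hTtd : IsUnit (T₀ᵀ).det := by rwa [Matrix.det_transpose]
  have hTT : T₀ * T₀ᵀ = (Qinf Q B)⁻¹ := by
    have h1 : T₀ᵀ * Qinf Q B = T₀⁻¹ := (Matrix.inv_eq_left_inv hT₀S).symm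
    refine (Matrix.inv_eq_left_inv ?_).symm
    rw [Matrix.mul_assoc, h1, Matrix.mul_nonsing_inv _ hTd]
  have hQinf : (T₀ᵀ)⁻¹ * T₀⁻¹ = Qinf Q B := by
    rw [← Matrix.mul_inv_rev, hTT, Matrix.nonsing_inv_nonsing_inv _ hS.det_pos.ne'.isUnit]
  -- `R` and `T` are square roots of `S = A Q_∞ Aᵀ` and of `S⁻¹` for which `Tᵀ E S E T` is diagonal.
  -- They depend on `t`, but the bound `hsmall` only involves `R Rᵀ = S` and `T Tᵀ = S⁻¹`.
  set R := A * (T₀ᵀ)⁻¹ with hR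
  set T := (A⁻¹)ᵀ * T₀ with hT
  have hRR : R * Rᵀ = A * Qinf Q B * Aᵀ := by
    rw [← hQinf, hR, Matrix.transpose_mul, Matrix.transpose_nonsing_inv, Matrix.transpose_transpose]
    simp only [Matrix.mul_assoc]
  have hTT' : T * Tᵀ = (A⁻¹)ᵀ * (Qinf Q B)⁻¹ * A⁻¹ := by
    rw [← hTT, hT, Matrix.transpose_mul, Matrix.transpose_transpose]
    simp only [Matrix.mul_assoc]
  have hTA : Tᵀ * A = T₀ᵀ := by
    rw [hT, Matrix.transpose_mul, Matrix.transpose_transpose, Matrix.mul_assoc,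
      Matrix.nonsing_inv_mul _ hAd, Matrix.mul_one]
  have hTe : Tᵀ * Matrix.diagonal e * A = T₀ᵀ * NormedSpace.exp (t • B) := by
    rw [Matrix.mul_assoc, ← hAexp, ← Matrix.mul_assoc, hTA]
  have hK : Tᵀ * Matrix.diagonal e * (R * Rᵀ) * Matrix.diagonal e * T
      = 1 - Matrix.diagonal δ := by
    have h1 : Aᵀ * Matrix.diagonal e * T = (NormedSpace.exp (t • B))ᵀ * T₀ := by
      have := congrArg Matrix.transpose hTe
      simpa [Matrix.mul_assoc] using this
    have h2 := Qinf_eq_add htpos hint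
    calc Tᵀ * Matrix.diagonal e * (R * Rᵀ) * Matrix.diagonal e * T
        = (Tᵀ * Matrix.diagonal e * A) * Qinf Q B * (Aᵀ * Matrix.diagonal e * T) := by
          rw [hRR]; simp only [Matrix.mul_assoc]
      _ = T₀ᵀ * (NormedSpace.exp (t • B) * Qinf Q B * (NormedSpace.exp (t • B))ᵀ) * T₀ := by
          rw [hTe, h1]; simp only [Matrix.mul_assoc]
      _ = T₀ᵀ * (Qinf Q B - Qt Q B t) * T₀ := by
          rw [← eq_sub_iff_add_eq'.2 h2.symm]
      _ = 1 - Matrix.diagonal δ := by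
          rw [Matrix.mul_sub, Matrix.sub_mul, hT₀S, hT₀P]
  have hker := kernel_eq (S := Qinf Q B) (P := Qt Q B t) (C := T₀ᵀ)
    ((Matrix.isUnit_iff_isUnit_det _).2 hTtd) hδ (by simpa using hT₀S) (by simpa using hT₀P)
    (NormedSpace.exp (t • B) *ᵥ x - y)
  have hvec : Tᵀ *ᵥ (A *ᵥ y - Matrix.diagonal e *ᵥ (A *ᵥ x))
      = -(T₀ᵀ *ᵥ (NormedSpace.exp (t • B) *ᵥ x - y)) := by
    rw [Matrix.mulVec_sub, Matrix.mulVec_sub, Matrix.mulVec_mulVec, Matrix.mulVec_mulVec,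
      Matrix.mulVec_mulVec, Matrix.mulVec_mulVec, hTA, hTe, neg_sub]
  have key := hasSum_integral_mul_integral R T (A *ᵥ x) (A *ᵥ y) e δ
    (fun k => (Real.exp_pos _).le) (by rw [hRR, hTT']; exact hsmall t ht) hδ hK
  have key2 := key.mul_left ((Real.exp (1 / 2 * (((Qinf Q B)⁻¹ *ᵥ y) ⬝ᵥ y)) : ℝ) : ℂ)
  rw [hvec] at key2
  simp only [Pi.neg_apply, neg_sq] at key2
  rw [hker.1, hker.2, ← Complex.ofReal_mul, mul_left_comm, ← Real.exp_add, neg_mul,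
    ← sub_eq_add_neg] at key2
  refine Complex.hasSum_ofReal.1 (Eq.mp (congrArg (HasSum · _) (funext fun n => ?_)) key2)
  rw [Complex.ofReal_mul, Complex.ofReal_mul, ofReal_eigenfun Q B M R l ϱ hRR,
    ofReal_coeigenfun Q B M T l ϱ hS.det_pos hTT', exp_neg_mul_pairing]
  have hfac : ((Real.sqrt (multiFactorial n) : ℝ) : ℂ) * (Real.sqrt (multiFactorial n) : ℝ)
      = ∏ k, ((n k).factorial : ℂ) := by
    rw [← Complex.ofReal_mul, Real.mul_self_sqrt (Nat.cast_nonneg _), multiFactorial]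
    push_cast
    rfl
  rw [Finset.prod_div_distrib, Complex.ofReal_div]
  have hfac' : ((∏ k, ((n k).factorial : ℝ) : ℝ) : ℂ) = (Real.sqrt (multiFactorial n) : ℝ) *
      (Real.sqrt (multiFactorial n) : ℝ) := by
    rw [hfac]; push_cast; rfl
  rw [hfac']
  simp only [div_eq_mul_inv, mul_inv]
  ring
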